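/- Let $V=\bigoplus_{n=0}^{\infty}V_n$ be a vertex operator algebra over $\mathbb{C}$ (with $\dim V_n<\infty$ for all $n$), with vacuum $\mathbf 1$, and write $Y(a,z)=\sum_{n\in\mathbb{Z}}a_n z^{-n-1}$ for $a\in V$. Suppose that $V$ is strongly generated by finitely many homogeneous elements $x^1,\dots,x^n$, that is, $V$ is spanned by the vectors $$a^{1}_{-n_1}\cdots a^{r}_{-n_r}\mathbf 1,\qquad r\ge 0,\ a^{i}\in\{x^1,\dots,x^n\},\ n_i\ge 1 .$$ Then Zhu's algebra $A(V)$ is left noetherian. Here $A(V)=V/O(V)$, where $O(V)$ is the linear span of the elements $\operatorname{Res}_z Y(a,z)b\,\frac{(1+z)^{m}}{z^{2}}$ for $m\ge 0$, $a\in V_m$ and $b\in V$; its product is induced by the bilinear operation on $V$ given by $$a\ast b=\operatorname{Res}_z Y(a,z)b\,\frac{(1+z)^{m}}{z}=\sum_{j=0}^{m}\binom{m}{j}a_{j-1}b\qquad(a\in V_m,\ b\in V),$$ and its identity is $\mathbf 1+O(V)$. -/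

import Mathlib

/-- For a linear map `Y` from `V` to fields on `V`, `modeOf Y n a b` is `a_n b`, where
`Y(a,z) b = ∑ a_n b z^{-n-1}`. -/
noncomputable def modeOf {V : Type*} [AddCommGroup V] [Module ℂ V]
    (Y : V →ₗ[ℂ] VertexOperator ℂ V) (n : ℤ) : V →ₗ[ℂ] V →ₗ[ℂ] V :=
  LinearMap.proj n ∘ₗ VertexOperator.ncoeff ∘ₗ Y

/-- A vertex operator algebra over `ℂ`, graded by nonnegative weights.
Since `Y a` is a linear map into Laurent series, `a_n b = 0` for `n` large, and the sums in the
Borcherds identity (the component form of the Jacobi identity) have finitely many nonzero terms. -/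
class VertexOperatorAlgebra (V : Type*) [AddCommGroup V] [Module ℂ V] where
  /-- the weight space `V_n` -/
  gr : ℕ → Submodule ℂ V
  isInternal : DirectSum.IsInternal gr
  finite_gr : ∀ n, FiniteDimensional ℂ (gr n)
  /-- the state-field correspondence -/
  Y : V →ₗ[ℂ] VertexOperator ℂ V
  /-- the vacuum vector -/
  vac : V
  /-- the conformal vector -/
  conf : V
  /-- the central charge -/
  charge : ℂ
  vac_mem : vac ∈ gr 0
  conf_mem : conf ∈ gr 2
  vac_mode : ∀ (n : ℤ) (b : V), modeOf Y n vac b = if n = -1 then b else 0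
  mode_vac_of_nonneg : ∀ (a : V) (n : ℤ), 0 ≤ n → modeOf Y n a vac = 0
  mode_neg_one_vac : ∀ a : V, modeOf Y (-1) a vac = a
  borcherds : ∀ (a b c : V) (m n k : ℤ),
    ∑ᶠ i : ℕ, Ring.choose m i • modeOf Y (m + k - i) (modeOf Y (n + i) a b) c =
    ∑ᶠ i : ℕ, ((-1) ^ i * Ring.choose n i) •
      (modeOf Y (m + n - i) a (modeOf Y (k + i) b c)
        - n.negOnePow • modeOf Y (n + k - i) b (modeOf Y (m + i) a c))
  /-- the Virasoro relations for `L(n) = ω_{n+1}` -/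
  virasoro : ∀ (m n : ℤ) (v : V),
    modeOf Y (m + 1) conf (modeOf Y (n + 1) conf v)
        - modeOf Y (n + 1) conf (modeOf Y (m + 1) conf v) =
      ((m : ℂ) - n) • modeOf Y (m + n + 1) conf v
        + (if m + n = 0 then (((m : ℂ) ^ 3 - m) / 12 * charge) • v else 0)
  /-- `L(0)` acts on `V_n` as `n` -/
  L_zero : ∀ (n : ℕ), ∀ v ∈ gr n, modeOf Y 1 conf v = (n : ℂ) • v
  /-- `Y(L(-1)a, z) = d/dz Y(a, z)` -/
  L_neg_one : ∀ (a : V) (n : ℤ) (b : V),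
    modeOf Y n (modeOf Y 0 conf a) b = (-n : ℂ) • modeOf Y (n - 1) a b

namespace VertexOperatorAlgebra

variable {V : Type*} [AddCommGroup V] [Module ℂ V] [VertexOperatorAlgebra V]

/-- `mode n a b` is `a_n b`. -/
noncomputable def mode (n : ℤ) : V →ₗ[ℂ] V →ₗ[ℂ] V :=
  modeOf Y n

/-- A vector is homogeneous if it lies in some weight space. -/
def IsHomogeneous (a : V) : Prop := ∃ n : ℕ, a ∈ gr (V := V) n

/-- `V` is strongly generated by `U` if it is spanned by the vectors
`a¹_{-n₁} ⋯ aʳ_{-nᵣ} 𝟏` with `r ≥ 0`, `aⁱ ∈ U` and `nᵢ ≥ 1`. -/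
def StronglyGeneratedBy (U : Set V) : Prop :=
  Submodule.span ℂ {v : V | ∃ l : List (V × ℕ), (∀ x ∈ l, x.1 ∈ U ∧ 1 ≤ x.2) ∧
    v = l.foldr (fun x w => mode (-(x.2 : ℤ)) x.1 w) vac} = ⊤

/-- `resProd p r a b = Res_z Y(a,z) b (1+z)^p z^r = ∑_{j=0}^p (p choose j) a_{j+r} b`. -/
noncomputable def resProd (p : ℕ) (r : ℤ) : V →ₗ[ℂ] V →ₗ[ℂ] V :=
  ∑ j ∈ Finset.range (p + 1), (p.choose j) • mode ((j : ℤ) + r)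

variable (V) in
/-- The decomposition of `V` into weight spaces, as a linear equivalence. -/
noncomputable def grEquiv : DirectSum ℕ (fun n => gr (V := V) n) ≃ₗ[ℂ] V :=
  LinearEquiv.ofBijective (DirectSum.coeLinearMap (gr (V := V))) isInternal

/-- Zhu's product: the bilinear map with
`a ∗ b = Res_z Y(a,z) b (1+z)^{wt a} / z` for homogeneous `a`. -/
noncomputable def zhuMul : V →ₗ[ℂ] V →ₗ[ℂ] V :=
  DirectSum.toModule ℂ ℕ (V →ₗ[ℂ] V)
      (fun p => resProd p (-1) ∘ₗ (gr (V := V) p).subtype) ∘ₗ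
    (grEquiv V).symm.toLinearMap

variable (V) in
/-- `O(V)`: the span of the elements `Res_z Y(a,z) b (1+z)^{wt a} / z²`
with `a` homogeneous. -/
noncomputable def zhuO : Submodule ℂ V :=
  Submodule.span ℂ {v : V | ∃ p : ℕ, ∃ a ∈ gr (V := V) p, ∃ b : V, v = resProd p (-2) a b}

/-! ### `O(V)` is a two-sided ideal and the product is associative modulo `O(V)` -/

theorem mode_apply (n : ℤ) (a b : V) : mode n a b = modeOf Y n a b := rfl

theorem mode_trunc (a b : V) : ∃ N : ℤ, ∀ n, N ≤ n → mode n a b = 0 :=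
  ⟨-HahnSeries.order ((HahnModule.of ℂ).symm (Y a b)), fun n hn => by
    exact VertexOperator.ncoeff_eq_zero_of_lt_order _ _ _ (by linarith)⟩

theorem resProd_apply (p : ℕ) (r : ℤ) (a b : V) : resProd p r a b =
    ∑ j ∈ Finset.range (p + 1), (p.choose j) • mode ((j : ℤ) + r) a b := by
  simp [resProd, LinearMap.sum_apply]

theorem grEquiv_of (p : ℕ) (a : gr (V := V) p) :
    grEquiv V (DirectSum.of (fun n => gr (V := V) n) p a) = (a : V) :=
  DirectSum.coeLinearMap_of (gr (V := V)) p a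

theorem zhuMul_of_mem {p : ℕ} {a : V} (ha : a ∈ gr (V := V) p) (b : V) :
    zhuMul a b = resProd p (-1) a b := by
  have h : (grEquiv V).symm a = DirectSum.lof ℂ ℕ (fun i => gr (V := V) i) p ⟨a, ha⟩ := by
    rw [LinearEquiv.symm_apply_eq]
    exact (grEquiv_of p ⟨a, ha⟩).symm
  simp [zhuMul, h, DirectSum.toModule_lof]

/-- Pascal's rule. -/
theorem resProd_succ (p : ℕ) (r : ℤ) (a b : V) :
    resProd (p + 1) r a b = resProd p r a b + resProd p (r + 1) a b := by
  simp only [resProd_apply]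
  rw [Finset.sum_range_succ' _ (p + 1)]
  simp only [Nat.choose_succ_succ, add_smul, Finset.sum_add_distrib]
  have h := Finset.sum_range_succ' (fun j => p.choose j • mode ((j : ℤ) + r) a b) (p + 1)
  rw [Finset.sum_range_succ _ (p + 1), Nat.choose_succ_self, zero_smul, add_zero] at h
  rw [h, Nat.choose_zero_right, Nat.choose_zero_right, add_assoc, add_comm]
  congr 1
  refine Finset.sum_congr rfl fun j _ => ?_
  have e : ((j + 1 : ℕ) : ℤ) + r = j + (r + 1) := by push_cast; ring
  rw [e]

theorem sum_mul_choose (p : ℕ) (r : ℤ) (a b : V) :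
    ∑ j ∈ Finset.range (p + 2), ((j : ℂ) * ((p + 1).choose j : ℂ)) • mode ((j : ℤ) + r) a b =
      ((p : ℂ) + 1) • resProd p (r + 1) a b := by
  rw [Finset.sum_range_succ', resProd_apply, Finset.smul_sum]
  simp only [Nat.cast_zero, zero_mul, zero_smul, add_zero]
  refine Finset.sum_congr rfl fun j _ => ?_
  rw [← Nat.cast_smul_eq_nsmul ℂ, smul_smul]
  congr 1
  · have := Nat.add_one_mul_choose_eq p j
    have h2 : ((p : ℂ) + 1) * (p.choose j : ℂ) = ((p + 1).choose (j + 1) : ℂ) * (j + 1) := by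
      exact_mod_cast this
    rw [h2]
    push_cast
    ring
  · push_cast
    ring_nf

/-- `L(-1)` -/
noncomputable def T : V →ₗ[ℂ] V := mode 0 (conf : V)

theorem mode_T (a b : V) (n : ℤ) : mode n (T a) b = (-n : ℂ) • mode (n - 1) a b :=
  L_neg_one a n b

theorem comm_formula (a b c : V) (k : ℤ) :
    mode 0 a (mode k b c) - mode k b (mode 0 a c) = mode k (mode 0 a b) c := by
  have h := borcherds a b c 0 0 k
  rw [finsum_eq_single _ 0, finsum_eq_single _ 0] at h
  · simpa [mode_apply] using h.symm
  · intro i hi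
    simp [Ring.choose_zero_pos ℤ (Nat.pos_of_ne_zero hi)]
  · intro i hi
    simp [Ring.choose_zero_pos ℤ (Nat.pos_of_ne_zero hi)]

theorem comm_formula_one (a b c : V) (k : ℤ) :
    mode 1 a (mode k b c) - mode k b (mode 1 a c) =
      mode (k + 1) (mode 0 a b) c + mode k (mode 1 a b) c := by
  have h := borcherds a b c 1 0 k
  rw [finsum_eq_sum_of_support_subset (s := Finset.range 2), finsum_eq_single _ 0] at h
  · simp [mode_apply, Finset.sum_range_succ] at h ⊢
    rw [← h, add_comm 1 k]
  · intro i hi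
    simp [Ring.choose_zero_pos ℤ (Nat.pos_of_ne_zero hi)]
  · intro i hi
    by_contra hi'
    simp only [Finset.coe_range, Set.mem_Iio, not_lt] at hi'
    apply hi
    have : Ring.choose (1 : ℤ) i = 0 := by
      have := Ring.choose_natCast (R := ℤ) 1 i
      rw [Nat.cast_one] at this
      rw [this, Nat.choose_eq_zero_of_lt (by omega)]
      simp
    simp [this]

theorem mem_gr_of_L_zero {v : V} {s : ℤ} (h : mode 1 conf v = (s : ℂ) • v) :
    (∀ n : ℕ, (n : ℤ) = s → v ∈ gr (V := V) n) ∧ (s < 0 → v = 0) := by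
  classical
  let e := grEquiv V
  obtain ⟨x, rfl⟩ := e.surjective v
  have key : ∀ y : DirectSum ℕ (fun i => gr (V := V) i), ∃ z : DirectSum ℕ (fun i => gr (V := V) i),
      mode 1 conf (e y) = e z ∧ ∀ i, z i = (i : ℂ) • y i := by
    intro y
    induction y using DirectSum.induction_on with
    | zero => exact ⟨0, by simp, by simp⟩
    | of i y =>
      refine ⟨DirectSum.of _ i ((i : ℂ) • y), ?_, ?_⟩
      · have h1 : ∀ w : gr (V := V) i, e (DirectSum.of _ i w) = (w : V) := fun w =>
          grEquiv_of i w
        rw [h1, h1]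
        exact L_zero i _ y.2
      · intro j
        by_cases hij : i = j
        · subst hij; simp
        · simp [DirectSum.of_eq_of_ne _ _ _ (Ne.symm hij)]
    | add y₁ y₂ h₁ h₂ =>
      obtain ⟨z₁, h₁, h₁'⟩ := h₁
      obtain ⟨z₂, h₂, h₂'⟩ := h₂
      exact ⟨z₁ + z₂, by simp [h₁, h₂], fun i => by simp [h₁', h₂']⟩
  obtain ⟨z, hz, hz'⟩ := key x
  rw [hz, ← map_smul] at h
  have h' := e.injective h
  have h0 : ∀ i : ℕ, (i : ℤ) ≠ s → x i = 0 := by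
    intro i hi
    have := hz' i
    rw [h'] at this
    have h3 : (s : ℂ) • x i = (i : ℂ) • x i := this
    have h4 : ((s : ℂ) - i) • x i = 0 := by rw [sub_smul, h3, sub_self]
    refine (smul_eq_zero.mp h4).resolve_left ?_
    refine sub_ne_zero.2 ?_
    exact_mod_cast hi.symm
  constructor
  · intro n hn
    have : x = DirectSum.of _ n (x n) := by
      refine DFinsupp.ext fun j => ?_
      by_cases hj : n = j
      · subst hj; exact (DirectSum.of_eq_same (β := fun i => gr (V := V) i) _ _).symm
      · exact (h0 j (by omega)).trans 
          (DirectSum.of_eq_of_ne (β := fun i => gr (V := V) i) _ _ _ (Ne.symm hj)).symm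
    rw [this]
    have h1 : e (DirectSum.of _ n (x n)) = ((x n : gr (V := V) n) : V) :=
      grEquiv_of n (x n)
    rw [h1]
    exact (x n).2
  · intro hs
    have : x = 0 := DFinsupp.ext fun j => h0 j (by omega)
    simp [this]

theorem L_zero_mode {p q : ℕ} {a b : V} (ha : a ∈ gr (V := V) p) (hb : b ∈ gr (V := V) q)
    (k : ℤ) : mode 1 conf (mode k a b) = ((p + q - k - 1 : ℤ) : ℂ) • mode k a b := by
  have h := comm_formula_one conf a b k
  have h1 : mode 1 conf a = (p : ℂ) • a := L_zero p a ha
  have h2 : mode 1 conf b = (q : ℂ) • b := L_zero q b hb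
  have h3 : mode (k + 1) (mode 0 conf a) b = (-(k + 1 : ℤ) : ℂ) • mode k a b := by
    have := mode_T a b (k + 1)
    rwa [add_sub_cancel_right] at this
  rw [h1, h2, h3, map_smul, map_smul, LinearMap.smul_apply, sub_eq_iff_eq_add] at h
  rw [h, ← add_smul, ← add_smul]
  congr 1
  push_cast
  ring

theorem mode_mem {p q s : ℕ} {a b : V} (ha : a ∈ gr (V := V) p) (hb : b ∈ gr (V := V) q)
    {k : ℤ} (hs : (s : ℤ) = p + q - k - 1) : mode k a b ∈ gr (V := V) s :=
  (mem_gr_of_L_zero (L_zero_mode ha hb k)).1 s hs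

theorem T_mem {p : ℕ} {a : V} (ha : a ∈ gr (V := V) p) : T a ∈ gr (V := V) (p + 1) :=
  mode_mem conf_mem ha (by push_cast; ring)

theorem homogeneous_induction {P : V → Prop} (h0 : P 0) (hadd : ∀ x y, P x → P y → P (x + y))
    (hgr : ∀ p : ℕ, ∀ a ∈ gr (V := V) p, P a) (a : V) : P a := by
  have h : a ∈ ⨆ i, gr (V := V) i := by
    rw [isInternal.submodule_iSup_eq_top]
    trivial
  exact Submodule.iSup_induction _ (motive := P) h hgr h0 hadd

theorem resProd_T (p : ℕ) (r : ℤ) (a b : V) : resProd (p + 1) r (T a) b =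
    (-r : ℂ) • resProd (p + 1) (r - 1) a b - ((p : ℂ) + 1) • resProd p r a b := by
  have h := sum_mul_choose p (r - 1) a b
  rw [sub_add_cancel] at h
  rw [← h, resProd_apply, resProd_apply, Finset.smul_sum, ← Finset.sum_sub_distrib]
  refine Finset.sum_congr rfl fun j _ => ?_
  rw [mode_T, ← Nat.cast_smul_eq_nsmul ℂ, ← Nat.cast_smul_eq_nsmul ℂ, smul_smul, smul_smul,
    add_sub_assoc, ← sub_smul]
  congr 1
  push_cast
  ring

theorem resProd_mem_aux (m : ℕ) : ∀ {p : ℕ} {a : V}, a ∈ gr (V := V) p → ∀ b : V,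
    resProd p (-2 - m) a b ∈ zhuO V := by
  induction m with
  | zero =>
    intro p a ha b
    exact Submodule.subset_span ⟨p, a, ha, b, by simp⟩
  | succ m ih =>
    intro p a ha b
    have h := ih (T_mem ha) b
    rw [resProd_T, resProd_succ, sub_add_cancel, smul_add, add_sub_assoc] at h
    have h2 := ih ha b
    have h3 := (Submodule.add_mem_iff_left _ (Submodule.sub_mem _
      (Submodule.smul_mem _ _ h2) (Submodule.smul_mem _ _ h2))).1 h
    have hne : (-((-2 - m : ℤ) : ℂ)) ≠ 0 := by
      have : (-2 - (m : ℤ)) ≠ 0 := by omega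
      exact neg_ne_zero.2 (by exact_mod_cast this)
    have h4 := (Submodule.smul_mem_iff _ hne).1 h3
    have h5 : (-2 - (m : ℤ) - 1) = -2 - ((m + 1 : ℕ) : ℤ) := by push_cast; ring
    rwa [h5] at h4

theorem resProd_mem (n : ℕ) : ∀ {m : ℕ}, n ≤ m → ∀ {p : ℕ} {a : V}, a ∈ gr (V := V) p → ∀ b : V,
    resProd (p + n) (-2 - m) a b ∈ zhuO V := by
  induction n with
  | zero => intro m _ p a ha b; exact resProd_mem_aux m ha b
  | succ n ih =>
    intro m hm p a ha b
    rw [← add_assoc, resProd_succ]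
    refine Submodule.add_mem _ (ih (by omega) ha b) ?_
    have h5 : (-2 - (m : ℤ) + 1) = -2 - ((m - 1 : ℕ) : ℤ) := by omega
    rw [h5]
    exact ih (by omega) ha b

/-- The Borcherds identity with `m, k + l` in place of `m, k`, as finite sums. -/
theorem borcherds_sum (a b c : V) (n k : ℤ) (P : ℕ) : ∃ N : ℕ, P < N ∧ ∀ m l : ℕ,
    ∑ i ∈ Finset.range N, (m.choose i) • mode (m + (k + l) - i) (mode (n + i) a b) c =
    ∑ i ∈ Finset.range N, ((-1) ^ i * Ring.choose n i) •
      (mode (m + n - i) a (mode (k + l + i) b c)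
        - n.negOnePow • mode (n + (k + l) - i) b (mode (m + i) a c)) := by
  obtain ⟨N₁, h₁⟩ := mode_trunc a b
  obtain ⟨N₂, h₂⟩ := mode_trunc b c
  obtain ⟨N₃, h₃⟩ := mode_trunc a c
  let N := P + 1 + (N₁ - n).toNat + (N₂ - k).toNat + N₃.toNat
  refine ⟨N, by omega, fun m l => ?_⟩
  have h := borcherds a b c m n (k + l)
  rw [finsum_eq_sum_of_support_subset (s := Finset.range N),
    finsum_eq_sum_of_support_subset (s := Finset.range N)] at h
  · simpa [mode_apply, Ring.choose_natCast] using h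
  · intro i hi
    by_contra hi'
    simp only [Finset.coe_range, Set.mem_Iio, not_lt] at hi'
    apply hi
    have e₂ := h₂ (k + l + i) (by omega)
    have e₃ := h₃ (m + i) (by omega)
    rw [mode_apply] at e₂ e₃
    simp [e₂, e₃]
  · intro i hi
    by_contra hi'
    simp only [Finset.coe_range, Set.mem_Iio, not_lt] at hi'
    apply hi
    have e₁ := h₁ (n + i) (by omega)
    rw [mode_apply] at e₁
    simp [e₁]

/-- `∑_{m,l} (P choose m) (Q choose l) (m choose i) x_{m+l+k-i} =
(P choose i) Res (1+z)^{P-i+Q} z^k`. -/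
theorem sum_resProd (P Q i : ℕ) (hi : i ≤ P) (k : ℤ) (x c : V) :
    ∑ m ∈ Finset.range (P + 1), ∑ l ∈ Finset.range (Q + 1), (P.choose m) • (Q.choose l) •
      (m.choose i) • mode (m + (k + l) - i) x c = (P.choose i) • resProd (P - i + Q) k x c := by
  have hQ : ∀ (Q R : ℕ) (k : ℤ), resProd (R + Q) k x c =
      ∑ l ∈ Finset.range (Q + 1), (Q.choose l) • resProd R (k + l) x c := by
    intro Q R
    induction R with
    | zero => intro k; simp [resProd_apply, add_comm]
    | succ R ih =>
      intro k
      rw [add_right_comm, resProd_succ, ih, ih, ← Finset.sum_add_distrib]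
      refine Finset.sum_congr rfl fun l _ => ?_
      rw [resProd_succ, smul_add, add_right_comm k]
  rw [hQ, Finset.sum_comm, Finset.smul_sum]
  refine Finset.sum_congr rfl fun l _ => ?_
  rw [resProd_apply, Finset.smul_sum, Finset.smul_sum]
  obtain ⟨R, rfl⟩ := Nat.exists_eq_add_of_le hi
  rw [Nat.add_sub_cancel_left, add_assoc, Finset.sum_range_add, Finset.sum_eq_zero, zero_add]
  · refine Finset.sum_congr rfl fun j _ => ?_
    have h := Nat.choose_mul (n := i + R) (k := i + j) (s := i) (by omega)
    rw [Nat.add_sub_cancel_left, Nat.add_sub_cancel_left] at h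
    rw [smul_comm (Q.choose l) (Nat.choose (i + j) i), ← mul_smul, h, mul_smul,
      smul_comm (R.choose j)]
    have e : ((i + j : ℕ) : ℤ) + (k + l) - i = j + (k + l) := by push_cast; ring
    rw [e]
  · intro m hm
    rw [Nat.choose_eq_zero_of_lt (Finset.mem_range.1 hm)]
    simp

/-- The residue of the Jacobi identity against `(1+z)^P (1+w)^Q w^k (z-w)^n`. -/
theorem jacobi_resProd (a b c : V) (n k : ℤ) (P Q : ℕ) : ∃ N : ℕ, 0 < N ∧
    ∑ i ∈ Finset.range (P + 1),
      (P.choose i) • resProd (P - i + Q) k (mode (i + n) a b) c =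
    ∑ i ∈ Finset.range N, ((-1) ^ i * Ring.choose n i) •
      (resProd P (n - i) a (resProd Q (k + i) b c)
        - n.negOnePow • resProd Q (n + k - i) b (resProd P i a c)) := by
  obtain ⟨N, hN, h⟩ := borcherds_sum a b c n k P
  refine ⟨N, by omega, ?_⟩
  have h' : ∑ m ∈ Finset.range (P + 1), ∑ l ∈ Finset.range (Q + 1), (P.choose m) • (Q.choose l) •
      ∑ i ∈ Finset.range N, (m.choose i) • mode (m + (k + l) - i) (mode (n + i) a b) c =
      ∑ m ∈ Finset.range (P + 1), ∑ l ∈ Finset.range (Q + 1), (P.choose m) • (Q.choose l) •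
      ∑ i ∈ Finset.range N, ((-1) ^ i * Ring.choose n i) •
      (mode (m + n - i) a (mode (k + l + i) b c)
        - n.negOnePow • mode (n + (k + l) - i) b (mode (m + i) a c)) :=
    Finset.sum_congr rfl fun m _ => Finset.sum_congr rfl fun l _ => by rw [h]
  have swap : ∀ F : ℕ → ℕ → ℕ → V,
      ∑ m ∈ Finset.range (P + 1), ∑ l ∈ Finset.range (Q + 1), (P.choose m) • (Q.choose l) •
        ∑ i ∈ Finset.range N, F m l i =
      ∑ i ∈ Finset.range N, ∑ m ∈ Finset.range (P + 1), ∑ l ∈ Finset.range (Q + 1),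
        (P.choose m) • (Q.choose l) • F m l i := by
    intro F
    simp only [Finset.smul_sum]
    rw [Finset.sum_comm]
    rw [Finset.sum_congr rfl fun l _ => Finset.sum_comm]
    rw [Finset.sum_comm]
    exact Finset.sum_congr rfl fun i _ => Finset.sum_comm
  rw [swap, swap] at h'
  have hL : ∑ i ∈ Finset.range (P + 1),
      (P.choose i) • resProd (P - i + Q) k (mode (i + n) a b) c =
      ∑ i ∈ Finset.range N, ∑ m ∈ Finset.range (P + 1), ∑ l ∈ Finset.range (Q + 1),
        (P.choose m) • (Q.choose l) •
          (m.choose i) • mode (m + (k + l) - i) (mode (n + i) a b) c := by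
    rw [← Finset.sum_subset (Finset.range_subset_range.2 (Nat.succ_le_of_lt hN))]
    · refine Finset.sum_congr rfl fun i hi => ?_
      rw [sum_resProd P Q i (by simpa [Nat.lt_succ_iff] using hi), add_comm n]
    · intro i _ hi
      refine Finset.sum_eq_zero fun m hm => Finset.sum_eq_zero fun l _ => ?_
      simp only [Finset.mem_range, not_lt] at hi hm
      rw [Nat.choose_eq_zero_of_lt (n := m) (k := i) (by omega)]
      simp
  rw [hL, h']
  refine Finset.sum_congr rfl fun i _ => ?_
  have e1 : resProd P (n - i) a (resProd Q (k + i) b c) =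
      ∑ m ∈ Finset.range (P + 1), ∑ l ∈ Finset.range (Q + 1), (P.choose m) • (Q.choose l) •
        mode (m + n - i) a (mode (k + l + i) b c) := by
    rw [resProd_apply]
    refine Finset.sum_congr rfl fun m _ => ?_
    rw [resProd_apply, map_sum, Finset.smul_sum]
    refine Finset.sum_congr rfl fun l _ => ?_
    have e : (l : ℤ) + (k + i) = k + l + i := by ring
    rw [map_nsmul, add_sub_assoc, e]
  have e2 : resProd Q (n + k - i) b (resProd P i a c) =
      ∑ m ∈ Finset.range (P + 1), ∑ l ∈ Finset.range (Q + 1), (P.choose m) • (Q.choose l) •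
        mode (n + (k + l) - i) b (mode (m + i) a c) := by
    rw [resProd_apply, Finset.sum_comm]
    refine Finset.sum_congr rfl fun l _ => ?_
    rw [resProd_apply, map_sum, Finset.smul_sum]
    refine Finset.sum_congr rfl fun m _ => ?_
    rw [map_nsmul, smul_comm]
    have e : (l : ℤ) + (n + k - i) = n + (k + l) - i := by ring
    rw [e]
  rw [e1, e2]
  simp only [Finset.smul_sum, ← Finset.sum_sub_distrib]
  refine Finset.sum_congr rfl fun m _ => Finset.sum_congr rfl fun l _ => ?_
  rw [smul_comm (Q.choose l), smul_comm (P.choose m), smul_sub, smul_sub,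
    smul_comm (Q.choose l) n.negOnePow, smul_comm (P.choose m) n.negOnePow]

theorem zhuO_mul_of_mem {p q : ℕ} {a b : V} (ha : a ∈ gr (V := V) p) (hb : b ∈ gr (V := V) q)
    (c : V) : zhuMul (resProd p (-2) a b) c ∈ zhuO V := by
  obtain ⟨N, -, h⟩ := jacobi_resProd a b c (-2) (-1) p (q + 1)
  have hL : zhuMul (resProd p (-2) a b) c = ∑ i ∈ Finset.range (p + 1),
      (p.choose i) • resProd (p - i + (q + 1)) (-1) (mode (i + (-2)) a b) c := by
    rw [resProd_apply, map_sum, LinearMap.sum_apply]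
    refine Finset.sum_congr rfl fun i hi => ?_
    rw [map_nsmul, LinearMap.smul_apply, zhuMul_of_mem (mode_mem ha hb _)]
    have := Finset.mem_range.1 hi
    omega
  rw [hL, h]
  refine Submodule.sum_mem _ fun i _ => zsmul_mem (Submodule.sub_mem _ ?_ ?_) _
  · exact resProd_mem_aux i ha _
  · have : (-2 + -1 - (i : ℤ)) = -2 - ((i + 1 : ℕ) : ℤ) := by push_cast; ring
    rw [this, Units.smul_def]
    exact zsmul_mem (resProd_mem 1 (by omega) hb _) _

theorem zhuO_mul {x : V} (hx : x ∈ zhuO V) (c : V) : zhuMul x c ∈ zhuO V := by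
  have : zhuO V ≤ (zhuO V).comap (zhuMul.flip c) := by
    rw [zhuO, Submodule.span_le]
    rintro _ ⟨p, a, ha, b, rfl⟩
    change zhuMul (resProd p (-2) a b) c ∈ zhuO V
    induction b using homogeneous_induction with
    | h0 => simp
    | hadd x y hx hy =>
      rw [map_add, map_add, LinearMap.add_apply]
      exact Submodule.add_mem _ hx hy
    | hgr q b hb => exact zhuO_mul_of_mem ha hb c
  exact this hx

theorem zhuMul_assoc_of_mem {p q : ℕ} {a b : V} (ha : a ∈ gr (V := V) p)
    (hb : b ∈ gr (V := V) q) (c : V) :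
    zhuMul (zhuMul a b) c - zhuMul a (zhuMul b c) ∈ zhuO V := by
  obtain ⟨N, hN, h⟩ := jacobi_resProd a b c (-1) (-1) p q
  have hL : zhuMul (zhuMul a b) c = ∑ i ∈ Finset.range (p + 1),
      (p.choose i) • resProd (p - i + q) (-1) (mode (i + (-1)) a b) c := by
    rw [zhuMul_of_mem ha, resProd_apply, map_sum, LinearMap.sum_apply]
    refine Finset.sum_congr rfl fun i hi => ?_
    rw [map_nsmul, LinearMap.smul_apply, zhuMul_of_mem (mode_mem ha hb _)]
    have := Finset.mem_range.1 hi
    omega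
  have hsecond : ∀ i : ℕ, resProd q (-1 + -1 - (i : ℤ)) b (resProd p i a c) ∈ zhuO V := fun i =>
    resProd_mem_aux i hb _
  obtain ⟨M, rfl⟩ := Nat.exists_eq_succ_of_ne_zero hN.ne'
  rw [hL, h, Finset.sum_range_succ', zhuMul_of_mem ha, zhuMul_of_mem hb, add_sub_assoc]
  refine Submodule.add_mem _ (Submodule.sum_mem _ fun i _ =>
    zsmul_mem (Submodule.sub_mem _ ?_ ?_) _) ?_
  · have : (-1 - ((i + 1 : ℕ) : ℤ)) = -2 - (i : ℤ) := by push_cast; ring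
    rw [this]
    exact resProd_mem_aux i ha _
  · rw [Units.smul_def]
    exact zsmul_mem (hsecond _) _
  · have h0 := hsecond 0
    simp only [Nat.cast_zero, sub_zero, add_zero, pow_zero, Ring.choose_zero_right, mul_one,
      one_smul] at h0 ⊢
    rw [sub_sub_cancel_left, Units.smul_def]
    exact neg_mem (zsmul_mem h0 _)

theorem zhuMul_assoc (a b c : V) :
    zhuMul (zhuMul a b) c - zhuMul a (zhuMul b c) ∈ zhuO V := by
  induction a using homogeneous_induction with
  | h0 => simp
  | hadd x y hx hy =>
    simp only [map_add, LinearMap.add_apply]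
    rw [add_sub_add_comm]
    exact Submodule.add_mem _ hx hy
  | hgr p a ha =>
    induction b using homogeneous_induction with
    | h0 => simp
    | hadd x y hx hy =>
      simp only [map_add, LinearMap.add_apply]
      rw [add_sub_add_comm]
      exact Submodule.add_mem _ hx hy
    | hgr q b hb => exact zhuMul_assoc_of_mem ha hb c

theorem vac_zhuMul (b : V) : zhuMul vac b = b := by
  rw [zhuMul_of_mem vac_mem, resProd_apply]
  simp [mode_apply, vac_mode]

theorem resProd_vac (p : ℕ) (a : V) : resProd p (-1) a vac = a := by
  rw [resProd_apply, Finset.sum_range_succ', Finset.sum_eq_zero]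
  · have := mode_neg_one_vac a
    rw [← mode_apply] at this
    simpa using this
  · intro i _
    rw [mode_apply, mode_vac_of_nonneg a _ (by push_cast; omega), smul_zero]

theorem zhuMul_vac (a : V) : zhuMul a vac = a := by
  induction a using homogeneous_induction with
  | h0 => simp
  | hadd x y hx hy => rw [map_add, LinearMap.add_apply, hx, hy]
  | hgr p a ha => rw [zhuMul_of_mem ha, resProd_vac]

theorem zhuMul_T_add {q : ℕ} {b : V} (hb : b ∈ gr (V := V) q) (c : V) :
    zhuMul (T b + (q : ℂ) • b) c = resProd q (-2) b c := by
  rw [map_add, map_smul, LinearMap.add_apply, LinearMap.smul_apply, zhuMul_of_mem (T_mem hb),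
    zhuMul_of_mem hb, resProd_T, resProd_succ]
  norm_num
  module

theorem T_add_mem {q : ℕ} {b : V} (hb : b ∈ gr (V := V) q) : T b + (q : ℂ) • b ∈ zhuO V := by
  rw [← zhuMul_vac (T b + _), zhuMul_T_add hb]
  exact resProd_mem_aux 0 hb vac

theorem mul_T_add_mem {p q : ℕ} {a b : V} (ha : a ∈ gr (V := V) p) (hb : b ∈ gr (V := V) q) :
    zhuMul a (T b + (q : ℂ) • b) ∈ zhuO V := by
  have hT : ∀ j : ℤ, mode j a (T b) = T (mode j a b) - mode j (T a) b := fun j => by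
    have := comm_formula conf a b j
    rw [eq_sub_iff_add_eq, add_comm, ← eq_sub_iff_add_eq]
    exact this.symm
  have h1 : ∀ j ∈ Finset.range (p + 1), p.choose j •
      (T (mode (j + (-1)) a b) + ((p : ℂ) + q - j) • mode (j + (-1)) a b) ∈ zhuO V := by
    intro j hj
    have hj := Finset.mem_range.1 hj
    refine nsmul_mem ?_ _
    have := T_add_mem (mode_mem (s := p + q - j) (k := j + (-1)) ha hb (by omega))
    rwa [Nat.cast_sub (by omega), Nat.cast_add] at this
  have h2 := Submodule.sum_mem _ h1
  have h3 : zhuMul a (T b + (q : ℂ) • b) =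
      (∑ j ∈ Finset.range (p + 1), p.choose j •
        (T (mode (j + (-1)) a b) + ((p : ℂ) + q - j) • mode (j + (-1)) a b))
      - resProd p (-2) a b := by
    have h4 : ∑ j ∈ Finset.range (p + 1), (p.choose j : ℂ) • ((p : ℂ) - j) • mode (j + (-1)) a b =
        ∑ j ∈ Finset.range (p + 1), ((j : ℂ) * (p.choose j : ℂ)) • mode (j + (-2)) a b := by
      rw [Finset.sum_range_succ, Finset.sum_range_succ']
      simp only [sub_self, zero_smul, smul_zero, add_zero, Nat.cast_zero, zero_mul]
      refine Finset.sum_congr rfl fun j hj => ?_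
      rw [smul_smul]
      have hj := Finset.mem_range.1 hj
      congr 1
      · have h5 := Nat.choose_succ_right_eq p j
        have h6 : (p.choose (j + 1) : ℂ) * (j + 1) = p.choose j * (p - j : ℕ) := by
          exact_mod_cast h5
        rw [Nat.cast_sub hj.le] at h6
        rw [← h6]
        push_cast
        ring
      · push_cast
        ring_nf
    rw [zhuMul_of_mem ha, resProd_apply, resProd_apply, ← Finset.sum_sub_distrib, ← sub_eq_zero,
      ← Finset.sum_sub_distrib]
    rw [← sub_eq_zero, ← Finset.sum_sub_distrib, ← neg_eq_zero, ← Finset.sum_neg_distrib] at h4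
    rw [← h4]
    refine Finset.sum_congr rfl fun j _ => ?_
    rw [map_add, map_smul, hT, mode_T]
    have e : (j : ℤ) + -1 - 1 = j + -2 := by ring
    rw [e]
    simp only [← Nat.cast_smul_eq_nsmul ℂ]
    push_cast
    module
  rw [h3]
  exact Submodule.sub_mem _ h2 (resProd_mem_aux 0 ha b)

theorem mul_zhuO (a : V) {x : V} (hx : x ∈ zhuO V) : zhuMul a x ∈ zhuO V := by
  have : zhuO V ≤ (zhuO V).comap (zhuMul a) := by
    rw [zhuO, Submodule.span_le]
    rintro _ ⟨q, b, hb, c, rfl⟩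
    change zhuMul a (resProd q (-2) b c) ∈ zhuO V
    rw [← zhuMul_T_add hb]
    have h := zhuMul_assoc a (T b + (q : ℂ) • b) c
    refine (Submodule.sub_mem_iff_right _ (zhuO_mul ?_ c)).1 h
    induction a using homogeneous_induction with
    | h0 => simp
    | hadd x y hx hy =>
      rw [map_add zhuMul, LinearMap.add_apply]
      refine Submodule.add_mem _ (hx (zhuMul_assoc _ _ _)) (hy (zhuMul_assoc _ _ _))
    | hgr p a ha => exact mul_T_add_mem ha hb
  exact this hx

variable (V) in
/-- Zhu's algebra `A(V) = V / O(V)`. -/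
def ZhuAlgebra : Type _ := V ⧸ zhuO V

namespace ZhuAlgebra

noncomputable instance : AddCommGroup (ZhuAlgebra V) :=
  inferInstanceAs (AddCommGroup (V ⧸ zhuO V))

noncomputable instance : Module ℂ (ZhuAlgebra V) :=
  inferInstanceAs (Module ℂ (V ⧸ zhuO V))

variable (V) in
/-- The projection `V → A(V)`. -/
noncomputable def mk : V →ₗ[ℂ] ZhuAlgebra V := (zhuO V).mkQ

theorem mk_surjective : Function.Surjective (mk V) := (zhuO V).mkQ_surjective

theorem mk_eq_iff {a b : V} : mk V a = mk V b ↔ a - b ∈ zhuO V := Submodule.Quotient.eq _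

/-- The product of `A(V)`, induced by Zhu's product on `V`. -/
noncomputable def mulMap : ZhuAlgebra V →ₗ[ℂ] ZhuAlgebra V →ₗ[ℂ] ZhuAlgebra V :=
  (zhuO V).liftQ
    { toFun := fun a => (zhuO V).liftQ (mk V ∘ₗ zhuMul a) (fun x hx => by
        rw [LinearMap.mem_ker, LinearMap.comp_apply, ← map_zero (mk V), mk_eq_iff, sub_zero]
        exact mul_zhuO a hx)
      map_add' := fun a b => by
        refine Submodule.linearMap_qext _ (LinearMap.ext fun x => ?_)
        change mk V (zhuMul (a + b) x) = mk V (zhuMul a x) + mk V (zhuMul b x)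
        simp
      map_smul' := fun r a => by
        refine Submodule.linearMap_qext _ (LinearMap.ext fun x => ?_)
        change mk V (zhuMul (r • a) x) = r • mk V (zhuMul a x)
        simp }
    (fun x hx => by
      rw [LinearMap.mem_ker]
      refine Submodule.linearMap_qext _ (LinearMap.ext fun y => ?_)
      change mk V (zhuMul x y) = 0
      rw [← map_zero (mk V), mk_eq_iff, sub_zero]
      exact zhuO_mul hx y)

/-- The ring structure of `A(V)`: the product is induced by `zhuMul`, the unit is the class of
the vacuum. -/
noncomputable instance : Ring (ZhuAlgebra V) where
  __ := (inferInstance : AddCommGroup (ZhuAlgebra V))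
  mul x y := mulMap x y
  one := mk V vac
  left_distrib x y z := map_add (mulMap x) y z
  right_distrib x y z := by
    change mulMap (x + y) z = mulMap x z + mulMap y z
    rw [map_add, LinearMap.add_apply]
  zero_mul x := by
    change mulMap 0 x = 0
    rw [map_zero, LinearMap.zero_apply]
  mul_zero x := map_zero (mulMap x)
  mul_assoc x y z := by
    obtain ⟨a, rfl⟩ := mk_surjective x
    obtain ⟨b, rfl⟩ := mk_surjective y
    obtain ⟨c, rfl⟩ := mk_surjective z
    exact mk_eq_iff.2 (zhuMul_assoc a b c)
  one_mul x := by
    obtain ⟨a, rfl⟩ := mk_surjective x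
    exact congrArg (mk V) (vac_zhuMul a)
  mul_one x := by
    obtain ⟨a, rfl⟩ := mk_surjective x
    exact congrArg (mk V) (zhuMul_vac a)

theorem mk_mul_mk (a b : V) : mk V a * mk V b = mk V (zhuMul a b) := rfl

theorem one_eq : (1 : ZhuAlgebra V) = mk V vac := rfl

end ZhuAlgebra

end VertexOperatorAlgebra

/-! Filter $A(V)$ by weight. In $a * b$ the leading term is $a_{-1}b$, and the other terms
$a_{j-1}b$, $j \ge 1$, have smaller weight, so the filtration is multiplicative. Two facts describe
its associated graded algebra. A vector $a_{-2-m}b$ has lower order in $A(V)$ than its weight,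
because it is the leading term of an element of $O(V)$ (`mk_mode_neg_mem`). By skew-symmetry,
$a_{-1}b - b_{-1}a$ is a combination of vectors $(a_i b)_{-2-i}\mathbf 1$, so it also drops in
order, and the graded algebra is commutative (`mk_mul_comm_mem`). Of the spanning monomials given by
strong generation, only those with every $n_i = 1$ survive in top degree, and up to lower order
these are products of the classes of the generators (`mk_foldr_mem`). Hence the graded algebra is a
quotient of a polynomial ring in finitely many variables.

The rest is the classical passage from the graded to the filtered algebra. The graded algebra is
never formed: to a left ideal corresponds the ideal of polynomials whose homogeneous components
represent symbols of its elements (`leadingIdeal`). This map is strictly monotone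
(`leadingIdeal_strictMono`), so Hilbert's basis theorem gives the ascending chain condition on left
ideals. Generators of weight $0$ are allowed throughout. -/

/-! ### Almost commutative filtered algebras -/

section Filtered

variable {K A σ : Type*} [Field K] [Ring A] [Algebra K A]

/-- The linear map from polynomials that sends a monomial to the product of the corresponding
elements of `A`, taken in some fixed order. -/
noncomputable def orderedEval (x : σ → A) : MvPolynomial σ K →ₗ[K] A :=
  (MvPolynomial.basisMonomials σ K).constr K
    (fun α => ((Finsupp.toMultiset α).toList.map x).prod)

theorem orderedEval_monomial (x : σ → A) (α : σ →₀ ℕ) :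
    orderedEval (K := K) x (MvPolynomial.monomial α 1) =
      ((Finsupp.toMultiset α).toList.map x).prod := by
  have := (MvPolynomial.basisMonomials σ K).constr_basis K
    (fun α => ((Finsupp.toMultiset α).toList.map x).prod) α
  rwa [MvPolynomial.coe_basisMonomials] at this

/-- An exhaustive filtration `G` of `A`, indexed so that `G (k + 1)` is the part of degree at most
`k`, for which the associated graded algebra is commutative and generated by the classes of
elements `x i` of degree `w i`. -/
structure IsAlmostCommFiltration (x : σ → A) (w : σ → ℕ) (G : ℕ → Submodule K A) : Prop where
  zero : G 0 = ⊥
  mono : Monotone G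
  exhaust : ∀ y, ∃ k, y ∈ G k
  one_mem : (1 : A) ∈ G 1
  mul_mem_succ : ∀ {k l : ℕ} {y z : A}, y ∈ G (k + 1) → z ∈ G (l + 1) → y * z ∈ G (k + l + 1)
  gen_mem : ∀ i, x i ∈ G (w i + 1)
  comm_mem : ∀ i j, x i * x j - x j * x i ∈ G (w i + w j)
  le_sup : ∀ k, G (k + 1) ≤
    G k ⊔ Submodule.span K {y | ∃ l : List σ, (l.map w).sum = k ∧ y = (l.map x).prod}

/-! ### Ordered monomials and ideals of leading forms. -/

namespace IsAlmostCommFiltration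

variable {x : σ → A} {w : σ → ℕ} {G : ℕ → Submodule K A}

theorem mul_mem_left (h : IsAlmostCommFiltration x w G) {k l : ℕ} {y z : A} (hy : y ∈ G (k + 1))
    (hz : z ∈ G l) : y * z ∈ G (k + l) := by
  cases l with
  | zero => rw [h.zero, Submodule.mem_bot] at hz; simp [hz]
  | succ l => exact h.mul_mem_succ hy hz

theorem mul_mem_right (h : IsAlmostCommFiltration x w G) {k l : ℕ} {y z : A} (hy : y ∈ G k)
    (hz : z ∈ G (l + 1)) : y * z ∈ G (k + l) := by
  cases k with
  | zero => rw [h.zero, Submodule.mem_bot] at hy; simp [hy]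
  | succ k => rw [add_right_comm]; exact h.mul_mem_succ hy hz

theorem prod_mem (h : IsAlmostCommFiltration x w G) (l : List σ) :
    (l.map x).prod ∈ G ((l.map w).sum + 1) := by
  induction l with
  | nil => simpa using h.one_mem
  | cons i l ih =>
    simpa [add_assoc] using h.mul_mem_succ (h.gen_mem i) ih

/-- Swapping two neighbouring factors costs a commutator, which has lower order by `comm_mem`, and
swaps generate all permutations. This makes the arbitrary order chosen in `orderedEval` harmless. -/
theorem prod_sub_prod_mem (h : IsAlmostCommFiltration x w G) {l l' : List σ} (hl : l.Perm l') :
    (l.map x).prod - (l'.map x).prod ∈ G (l.map w).sum := by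
  induction hl with
  | nil => simp
  | cons i _ ih =>
    simp only [List.map_cons, List.prod_cons, List.sum_cons, ← mul_sub]
    exact h.mul_mem_left (h.gen_mem i) ih
  | swap i j l =>
    have := h.mul_mem_right (h.comm_mem j i) (h.prod_mem l)
    simpa [sub_mul, mul_assoc, add_assoc] using this
  | trans h₁ _ ih₁ ih₂ =>
    rw [← (h₁.map w).sum_eq] at ih₂
    simpa using add_mem ih₁ ih₂

theorem sum_toList (w : σ → ℕ) (α : σ →₀ ℕ) :
    ((Finsupp.toMultiset α).toList.map w).sum = Finsupp.weight w α := by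
  rw [← Multiset.sum_coe, ← Multiset.map_coe, Multiset.coe_toList]
  induction α using Finsupp.induction_linear with
  | zero => simp
  | add f g hf hg => rw [map_add, map_add, Multiset.map_add, Multiset.sum_add, hf, hg]
  | single i m => simp [Finsupp.weight_single, Multiset.map_nsmul, Multiset.sum_nsmul]

/-- Multiplication by a variable corresponds to multiplication by `x i`, up to lower order
terms. -/
theorem orderedEval_X_mul_sub_mem (h : IsAlmostCommFiltration x w G) (i : σ) {k : ℕ}
    {f : MvPolynomial σ K} (hf : f ∈ MvPolynomial.weightedHomogeneousSubmodule K w k) :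
    orderedEval x (MvPolynomial.X i * f) - x i * orderedEval x f ∈ G (w i + k) := by
  -- By linearity it is enough to treat monomials of weight `k`, for which the two sides are
  -- products of the same factors in different orders.
  rw [MvPolynomial.weightedHomogeneousSubmodule_eq_finsupp_supported,
    AddMonoidAlgebra.supported_eq_span_single] at hf
  induction hf using Submodule.span_induction with
  | zero => simp
  | add f g _ _ hf hg =>
    rw [mul_add, map_add, map_add, mul_add, add_sub_add_comm]
    exact add_mem hf hg
  | smul c f _ hf =>
    rw [mul_smul_comm, map_smul, map_smul, mul_smul_comm, ← smul_sub]
    exact Submodule.smul_mem _ _ hf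
  | mem f hf =>
    obtain ⟨α, hα, rfl⟩ := hf
    change Finsupp.weight w α = k at hα
    change orderedEval x (MvPolynomial.X i * MvPolynomial.monomial α 1)
      - x i * orderedEval x (MvPolynomial.monomial α 1) ∈ _
    rw [MvPolynomial.X, MvPolynomial.monomial_mul, one_mul, orderedEval_monomial,
      orderedEval_monomial, ← List.prod_cons, ← List.map_cons]
    have hp : (Finsupp.toMultiset (Finsupp.single i 1 + α)).toList.Perm
        (i :: (Finsupp.toMultiset α).toList) := by
      rw [← Multiset.coe_eq_coe, Multiset.coe_toList, ← Multiset.cons_coe, Multiset.coe_toList]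
      simp
    have := h.prod_sub_prod_mem hp
    rwa [(hp.map w).sum_eq, List.map_cons, List.sum_cons, sum_toList, hα] at this

/-- The ideal of leading forms of a left ideal. -/
noncomputable def leadingIdeal (h : IsAlmostCommFiltration x w G) (I : Ideal A) :
    Ideal (MvPolynomial σ K) where
  -- Since `G k` is the part of degree below `k`, the condition says that the degree `k` component
  -- has the same symbol as some element of `I`. Imposing it on each component makes the ideal
  -- homogeneous.
  carrier := {f | ∀ k, orderedEval x (MvPolynomial.weightedHomogeneousComponent w k f) ∈
    I.restrictScalars K ⊔ G k}
  zero_mem' := by simp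
  add_mem' hf hg k := by
    rw [map_add, map_add]
    exact add_mem (hf k) (hg k)
  smul_mem' g f hf := by
    induction g using MvPolynomial.induction_on generalizing f with
    | C a =>
      intro k
      rw [smul_eq_mul, MvPolynomial.C_mul', map_smul, map_smul]
      exact Submodule.smul_mem _ _ (hf k)
    | add p q hp hq =>
      intro k
      rw [add_smul, map_add, map_add]
      exact add_mem (hp f hf k) (hq f hf k)
    | mul_X p i hp =>
      rw [mul_smul]
      refine hp _ fun k => ?_
      rw [smul_eq_mul]
      -- Multiplication by the variable shifts weights by `w i`, so the components of weight below
      -- `w i` vanish and the one of weight `w i + k` comes from that of weight `k`.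
      rcases lt_or_ge k (w i) with hk | hk
      · have : MvPolynomial.weightedHomogeneousComponent w k (MvPolynomial.X i * f) = 0 := by
          classical
          ext α
          rw [MvPolynomial.coeff_weightedHomogeneousComponent, MvPolynomial.coeff_X_mul',
            MvPolynomial.coeff_zero]
          split_ifs with h1 h2
          · have := Finsupp.le_weight_of_ne_zero' w (Finsupp.mem_support_iff.1 h2)
            omega
          · rfl
          · rfl
        rw [this, map_zero]
        exact zero_mem _
      · obtain ⟨k, rfl⟩ := Nat.exists_eq_add_of_le hk
        have e : MvPolynomial.weightedHomogeneousComponent w (w i + k) (MvPolynomial.X i * f) =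
            MvPolynomial.X i * MvPolynomial.weightedHomogeneousComponent w k f := by
          classical
          ext α
          rw [MvPolynomial.coeff_weightedHomogeneousComponent, MvPolynomial.coeff_X_mul',
            MvPolynomial.coeff_X_mul', MvPolynomial.coeff_weightedHomogeneousComponent]
          by_cases hi : i ∈ α.support
          · have := Finsupp.weight_sub_single_add (w := w) (Finsupp.mem_support_iff.1 hi)
            simp only [if_pos hi]
            congr 1
            exact propext ⟨fun _ => by omega, fun _ => by omega⟩
          · simp only [if_neg hi, ite_self]
        rw [e, ← sub_add_cancel (orderedEval x (MvPolynomial.X i * _)) (x i * orderedEval x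
          (MvPolynomial.weightedHomogeneousComponent w k f))]
        refine add_mem (Submodule.mem_sup_right (h.orderedEval_X_mul_sub_mem i
          (MvPolynomial.weightedHomogeneousComponent_mem w f k))) ?_
        -- Left multiplication by `x i` preserves the left ideal `I` and raises the order of the
        -- error term by `w i`.
        obtain ⟨y, hy, z, hz, hyz⟩ := Submodule.mem_sup.1 (hf k)
        rw [← hyz, mul_add]
        exact add_mem (Submodule.mem_sup_left (I.mul_mem_left _ hy))
          (Submodule.mem_sup_right (h.mul_mem_left (h.gen_mem i) hz))

theorem leadingIdeal_mono (h : IsAlmostCommFiltration x w G) {I I' : Ideal A} (hI : I ≤ I') :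
    h.leadingIdeal I ≤ h.leadingIdeal I' := fun _ hf k =>
  (sup_le_sup_right (fun _ hy => hI hy) _ : _ ≤ I'.restrictScalars K ⊔ G k) (hf k)

theorem orderedEval_of_mem_leadingIdeal (h : IsAlmostCommFiltration x w G) {I : Ideal A} {k : ℕ}
    {f : MvPolynomial σ K} (hf : MvPolynomial.IsWeightedHomogeneous w f k) :
    f ∈ h.leadingIdeal I ↔ orderedEval x f ∈ I.restrictScalars K ⊔ G k := by
  classical
  constructor
  · intro hfI
    have := hfI k
    rwa [MvPolynomial.weightedHomogeneousComponent_of_mem hf, if_pos rfl] at this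
  · intro hfk l
    rw [MvPolynomial.weightedHomogeneousComponent_of_mem hf]
    split_ifs with hl
    · rwa [← hl] at hfk
    · simp

/-- This is surjectivity of the polynomial ring onto the associated graded algebra: `le_sup`
supplies products of generators in any order, and reordering them changes only lower terms. -/
theorem exists_orderedEval_sub_mem (h : IsAlmostCommFiltration x w G) {k : ℕ} {y : A}
    (hy : y ∈ G (k + 1)) : ∃ f : MvPolynomial σ K, MvPolynomial.IsWeightedHomogeneous w f k ∧
      y - orderedEval x f ∈ G k := by
  obtain ⟨u, hu, v, hv, rfl⟩ := Submodule.mem_sup.1 (h.le_sup k hy)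
  suffices hs : ∃ f ∈ MvPolynomial.weightedHomogeneousSubmodule K w k,
      v - orderedEval x f ∈ G k by
    obtain ⟨f, hf, hvf⟩ := hs
    exact ⟨f, hf, by rw [add_sub_assoc]; exact add_mem hu hvf⟩
  clear hy
  induction hv using Submodule.span_induction with
  | zero => exact ⟨0, zero_mem _, by simp⟩
  | add _ _ _ _ ih₁ ih₂ =>
    obtain ⟨f₁, hf₁, h₁⟩ := ih₁
    obtain ⟨f₂, hf₂, h₂⟩ := ih₂
    refine ⟨f₁ + f₂, add_mem hf₁ hf₂, ?_⟩
    rw [map_add, add_sub_add_comm]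
    exact add_mem h₁ h₂
  | smul c _ _ ih =>
    obtain ⟨f, hf, h'⟩ := ih
    refine ⟨c • f, Submodule.smul_mem _ _ hf, ?_⟩
    rw [map_smul, ← smul_sub]
    exact Submodule.smul_mem _ _ h'
  | mem v hv =>
    classical
    obtain ⟨l, rfl, rfl⟩ := hv
    have hp : l.Perm (Finsupp.toMultiset (Multiset.toFinsupp (l : Multiset σ))).toList := by
      rw [← Multiset.coe_eq_coe, Multiset.coe_toList, Multiset.toFinsupp_toMultiset]
    refine ⟨MvPolynomial.monomial (Multiset.toFinsupp (l : Multiset σ)) 1,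
      MvPolynomial.isWeightedHomogeneous_monomial _ _ _ ?_, ?_⟩
    · rw [(hp.map w).sum_eq, sum_toList]
    · rw [orderedEval_monomial]
      exact h.prod_sub_prod_mem hp

/-- Induction on the degree of `y ∈ I'`. Its symbol is a leading form of `I'`, hence of `I`, so some
`u ∈ I` has the same symbol. The difference `y - u` has smaller degree and still lies in `I'`
because `I ≤ I'`, so it lies in `I`. -/
theorem le_of_leadingIdeal_le (h : IsAlmostCommFiltration x w G) {I I' : Ideal A} (hI : I ≤ I')
    (hJ : h.leadingIdeal I' ≤ h.leadingIdeal I) : I' ≤ I := by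
  suffices hs : ∀ k, ∀ y ∈ G k, y ∈ I' → y ∈ I by
    intro y hy
    obtain ⟨k, hk⟩ := h.exhaust y
    exact hs k y hk hy
  intro k
  induction k with
  | zero =>
    intro y hy _
    rw [h.zero, Submodule.mem_bot] at hy
    exact hy ▸ zero_mem _
  | succ k ih =>
    intro y hy hyI
    obtain ⟨f, hf, hyf⟩ := h.exists_orderedEval_sub_mem hy
    have hf' : f ∈ h.leadingIdeal I' := by
      rw [h.orderedEval_of_mem_leadingIdeal hf, ← sub_sub_cancel y (orderedEval x f)]
      exact sub_mem (Submodule.mem_sup_left hyI) (Submodule.mem_sup_right hyf)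
    obtain ⟨u, hu, v, hv, huv⟩ :=
      Submodule.mem_sup.1 ((h.orderedEval_of_mem_leadingIdeal hf).1 (hJ hf'))
    have hu : u ∈ I := hu
    have hyu : y - u ∈ G k := by
      have : y - u = (y - orderedEval x f) + v := by rw [← huv]; abel
      rw [this]
      exact add_mem hyf hv
    rw [← sub_add_cancel y u]
    exact add_mem (ih _ hyu (sub_mem hyI (hI hu))) hu

theorem leadingIdeal_strictMono (h : IsAlmostCommFiltration x w G) :
    StrictMono h.leadingIdeal := fun _ _ hI =>
  lt_of_le_not_ge (h.leadingIdeal_mono hI.le) fun hJ =>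
    hI.not_ge (h.le_of_leadingIdeal_le hI.le hJ)

/-- A filtered algebra whose associated graded algebra is commutative and finitely generated is
left noetherian. -/
theorem isNoetherianRing [Finite σ] (h : IsAlmostCommFiltration x w G) : IsNoetherianRing A := by
  -- Hilbert's basis theorem, which needs `σ` finite.
  have : WellFoundedGT (Ideal (MvPolynomial σ K)) := inferInstance
  have : WellFoundedGT (Ideal A) := h.leadingIdeal_strictMono.wellFoundedGT
  rw [isNoetherianRing_iff, isNoetherian_iff']
  exact this

end IsAlmostCommFiltration

end Filtered

namespace VertexOperatorAlgebra

variable {V : Type*} [AddCommGroup V] [Module ℂ V] [VertexOperatorAlgebra V]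

/-! ### The weight filtration of Zhu's algebra -/

namespace ZhuAlgebra

noncomputable instance : Algebra ℂ (ZhuAlgebra V) :=
  Algebra.ofModule
    (fun r x y => by
      change mulMap (r • x) y = r • mulMap x y
      rw [map_smul, LinearMap.smul_apply])
    (fun r x y => map_smul (mulMap x) r y)

variable (V) in
/-- The image in `A(V)` of the vectors of weight less than `k`. -/
noncomputable def fil (k : ℕ) : Submodule ℂ (ZhuAlgebra V) :=
  Submodule.span ℂ {y | ∃ j < k, ∃ a ∈ gr (V := V) j, y = mk V a}

theorem mk_mem_fil {j k : ℕ} (hj : j < k) {a : V} (ha : a ∈ gr (V := V) j) :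
    mk V a ∈ fil V k :=
  Submodule.subset_span ⟨j, hj, a, ha, rfl⟩

theorem fil_mono : Monotone (fil V) := fun _ _ h =>
  Submodule.span_mono fun _ ⟨j, hj, a, ha, e⟩ => ⟨j, hj.trans_le h, a, ha, e⟩

theorem fil_zero : fil V 0 = ⊥ := by
  rw [fil, Submodule.span_eq_bot]
  rintro _ ⟨j, hj, -⟩
  omega

theorem mk_mode_mem {p q N : ℕ} {a b : V} (ha : a ∈ gr (V := V) p) (hb : b ∈ gr (V := V) q)
    {k : ℤ} (hN : p + q - k - 1 < (N : ℤ)) : mk V (mode k a b) ∈ fil V N := by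
  rcases lt_or_ge ((p : ℤ) + q - k - 1) 0 with h | h
  -- There are no negative weights, so the vector itself is zero.
  · rw [(mem_gr_of_L_zero (L_zero_mode ha hb k)).2 h, map_zero]
    exact zero_mem _
  · obtain ⟨s, hs⟩ := Int.eq_ofNat_of_zero_le h
    exact mk_mem_fil (by omega) (mode_mem ha hb hs.symm)

/-- In `A(V)`, the vector `a_{-2-m} b` is congruent to vectors of lower weight. -/
theorem mk_mode_neg_mem {p q N : ℕ} {a b : V} (ha : a ∈ gr (V := V) p) (hb : b ∈ gr (V := V) q)
    (m : ℕ) (hN : p + q + m + 1 = N) : mk V (mode (-2 - m) a b) ∈ fil V N := by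
  have h : mk V (resProd p (-2 - m) a b) = 0 := by
    rw [← map_zero (mk V), mk_eq_iff, sub_zero]
    exact resProd_mem_aux m ha b
  -- The term `j = 0` is $a_{-2-m}b$ with coefficient $1$; each of the others has weight smaller by
  -- `j`.
  rw [resProd_apply, Finset.sum_range_succ', map_add, map_sum] at h
  simp only [Nat.choose_zero_right, one_smul, Nat.cast_zero, zero_add] at h
  rw [eq_neg_of_add_eq_zero_right h]
  refine neg_mem (sum_mem fun j _ => ?_)
  rw [map_nsmul]
  exact nsmul_mem (mk_mode_mem ha hb (by push_cast; omega)) _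

theorem mk_mul_mk_sub_mem {p q : ℕ} {a b : V} (ha : a ∈ gr (V := V) p)
    (hb : b ∈ gr (V := V) q) :
    mk V a * mk V b - mk V (mode (-1) a b) ∈ fil V (p + q) := by
  rw [mk_mul_mk, zhuMul_of_mem ha, resProd_apply, Finset.sum_range_succ', map_add, map_sum]
  simp only [Nat.choose_zero_right, one_smul, Nat.cast_zero, zero_add, add_sub_cancel_right]
  refine sum_mem fun j _ => ?_
  rw [map_nsmul]
  exact nsmul_mem (mk_mode_mem ha hb (by push_cast; omega)) _

/-- Skew-symmetry: the Borcherds identity with $c = \mathbf 1$, $m = k = -1$, $n = 0$ reads $a_{-1}b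
- b_{-1}a = \sum_i (-1)^i (a_i b)_{-2-i}\mathbf 1$. Each summand has weight $p + q$ and is congruent
to lower weight by `mk_mode_neg_mem`. -/
theorem mk_mode_neg_one_sub_mem {p q : ℕ} {a b : V} (ha : a ∈ gr (V := V) p)
    (hb : b ∈ gr (V := V) q) :
    mk V (mode (-1) a b) - mk V (mode (-1) b a) ∈ fil V (p + q) := by
  have h := borcherds a b vac (-1) 0 (-1)
  have hR : ∀ i : ℕ, i ≠ 0 → ((-1) ^ i * Ring.choose (0 : ℤ) i) •
      (modeOf Y (-1 + 0 - i) a (modeOf Y (-1 + i) b vac)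
        - (0 : ℤ).negOnePow • modeOf Y (0 + -1 - i) b (modeOf Y (-1 + i) a vac)) = 0 := by
    intro i hi
    simp [Ring.choose_zero_pos ℤ (Nat.pos_of_ne_zero hi)]
  rw [finsum_eq_single _ 0 hR] at h
  simp only [pow_zero, Ring.choose_zero_right, mul_one, one_smul, Int.negOnePow_zero, add_zero,
    Nat.cast_zero, sub_zero, zero_add, mode_neg_one_vac] at h
  rw [← map_sub, mode_apply, mode_apply, ← h]
  refine finsum_induction (fun v => mk V v ∈ fil V (p + q)) (by simp)
    (fun u v hu hv => by rw [map_add]; exact add_mem hu hv) fun i => ?_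
  rw [map_zsmul]
  refine zsmul_mem ?_ _
  change mk V (mode _ (mode _ a b) vac) ∈ _
  rcases lt_or_ge ((p : ℤ) + q - i - 1) 0 with hi | hi
  · rw [(mem_gr_of_L_zero (L_zero_mode ha hb i)).2 hi]
    simp
  · obtain ⟨s, hs⟩ := Int.eq_ofNat_of_zero_le hi
    have e : (-1 + -1 - i : ℤ) = -2 - i := by ring
    rw [e]
    exact mk_mode_neg_mem (mode_mem ha hb hs.symm) vac_mem i (by omega)

theorem mk_mul_comm_mem {p q : ℕ} {a b : V} (ha : a ∈ gr (V := V) p) (hb : b ∈ gr (V := V) q) :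
    mk V a * mk V b - mk V b * mk V a ∈ fil V (p + q) := by
  have h₁ := mk_mul_mk_sub_mem ha hb
  have h₂ := mk_mul_mk_sub_mem hb ha
  rw [add_comm q p] at h₂
  have := add_mem (sub_mem h₁ h₂) (mk_mode_neg_one_sub_mem ha hb)
  convert this using 1
  abel

theorem mul_mem_fil {k l : ℕ} {y z : ZhuAlgebra V} (hy : y ∈ fil V (k + 1))
    (hz : z ∈ fil V (l + 1)) : y * z ∈ fil V (k + l + 1) := by
  have := Submodule.mul_mem_mul hy hz
  refine (?_ : fil V (k + 1) * fil V (l + 1) ≤ _) this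
  rw [fil, fil, Submodule.span_mul_span, Submodule.span_le]
  rintro _ ⟨_, ⟨p, hp, a, ha, rfl⟩, _, ⟨q, hq, b, hb, rfl⟩, rfl⟩
  change mk V a * mk V b ∈ fil V (k + l + 1)
  rw [← sub_add_cancel (mk V a * mk V b) (mk V (mode (-1) a b))]
  exact add_mem (fil_mono (by omega) (mk_mul_mk_sub_mem ha hb)) (mk_mode_mem ha hb (by omega))

theorem exists_mem_fil (y : ZhuAlgebra V) : ∃ k, y ∈ fil V k := by
  obtain ⟨a, rfl⟩ := mk_surjective y
  induction a using homogeneous_induction with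
  | h0 => exact ⟨0, by simp⟩
  | hadd a b ha hb =>
    obtain ⟨k, hk⟩ := ha
    obtain ⟨l, hl⟩ := hb
    refine ⟨max k l, ?_⟩
    rw [map_add]
    exact add_mem (fil_mono (le_max_left _ _) hk) (fil_mono (le_max_right _ _) hl)
  | hgr p a ha => exact ⟨p + 1, mk_mem_fil p.lt_succ_self ha⟩

end ZhuAlgebra

/-! ### Strong generators -/

/-- The projection of `V` onto its weight space `V_k`. -/
noncomputable def weightProj (k : ℕ) : V →ₗ[ℂ] V :=
  (gr (V := V) k).subtype ∘ₗ DirectSum.component ℂ ℕ (fun n => gr (V := V) n) k ∘ₗ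
    (grEquiv V).symm.toLinearMap

theorem weightProj_of_mem {p : ℕ} {a : V} (ha : a ∈ gr (V := V) p) (k : ℕ) :
    weightProj k a = if p = k then a else 0 := by
  have h : (grEquiv V).symm a = DirectSum.lof ℂ ℕ (fun i => gr (V := V) i) p ⟨a, ha⟩ := by
    rw [LinearEquiv.symm_apply_eq]
    exact (grEquiv_of p ⟨a, ha⟩).symm
  simp only [weightProj, LinearMap.comp_apply, LinearEquiv.coe_coe, h, Submodule.subtype_apply]
  split_ifs with hp
  · subst hp
    rw [DirectSum.component.lof_self]
  · rw [DirectSum.component.of, dif_neg hp, Submodule.coe_zero]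

/-! ### Strong generators of `V` generate the associated graded algebra of `A(V)`. -/

namespace ZhuAlgebra

/-- Build the monomial from the vacuum outwards. A mode $-n$ with $n \ge 2$ sends everything to
lower order. The mode $-1$ is, up to lower order, left multiplication by the class of the generator,
which preserves the lower-order part and prolongs the products of generators. -/
theorem mk_foldr_mem {σ : Type*} {x : σ → V} {w : σ → ℕ} (hw : ∀ i, x i ∈ gr (V := V) (w i))
    (l : List (V × ℕ)) (hl : ∀ u ∈ l, u.1 ∈ Set.range x ∧ 1 ≤ u.2) :
    ∃ k, l.foldr (fun u v => mode (-(u.2 : ℤ)) u.1 v) vac ∈ gr (V := V) k ∧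
      mk V (l.foldr (fun u v => mode (-(u.2 : ℤ)) u.1 v) vac) ∈ fil V k ⊔
        Submodule.span ℂ {y | ∃ s : List σ, (s.map w).sum = k ∧
          y = (s.map fun i => mk V (x i)).prod} := by
  induction l with
  | nil => exact ⟨0, vac_mem, Submodule.mem_sup_right (Submodule.subset_span ⟨[], rfl, rfl⟩)⟩
  | cons u l ih =>
    obtain ⟨k, hk, hmem⟩ := ih fun u hu => hl u (List.mem_cons_of_mem _ hu)
    obtain ⟨⟨i, hi⟩, hn⟩ := hl u List.mem_cons_self
    rw [List.foldr_cons]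
    generalize l.foldr (fun u v => mode (-(u.2 : ℤ)) u.1 v) vac = v at hk hmem ⊢
    obtain ⟨a, n⟩ := u
    obtain rfl : x i = a := hi
    obtain ⟨n, rfl⟩ := Nat.exists_eq_add_of_le' hn
    refine ⟨w i + k + n, mode_mem (hw i) hk (by push_cast; ring), ?_⟩
    cases n with
    | succ m =>
      refine Submodule.mem_sup_left ?_
      have e : (-((m + 1 + 1 : ℕ) : ℤ)) = -2 - m := by push_cast; ring
      simp only [e]
      exact mk_mode_neg_mem (hw i) hk m (by omega)
    | zero =>
      simp only [zero_add, Nat.cast_one, add_zero]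
      rw [← sub_sub_cancel (mk V (x i) * mk V v) (mk V (mode (-1) (x i) v))]
      refine sub_mem ?_ (Submodule.mem_sup_left (mk_mul_mk_sub_mem (hw i) hk))
      obtain ⟨y, hy, z, hz, hyz⟩ := Submodule.mem_sup.1 hmem
      rw [← hyz, mul_add]
      refine add_mem (Submodule.mem_sup_left ?_) (Submodule.mem_sup_right ?_)
      -- `mul_mem_fil` needs a positive index; for `k = 0` the lower-order part is zero.
      · cases k with
        | zero => rw [fil_zero, Submodule.mem_bot] at hy; simp [hy]
        | succ k => exact mul_mem_fil (mk_mem_fil (Nat.lt_succ_self _) (hw i)) hy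
      · refine (Submodule.span_le.2 ?_ : _ ≤ (Submodule.span ℂ _).comap
          (LinearMap.mulLeft ℂ (mk V (x i)))) hz
        rintro _ ⟨s, rfl, rfl⟩
        exact Submodule.subset_span ⟨i :: s, rfl, rfl⟩

/-- A vector of weight `k` is a combination of monomials of possibly different weights. Projecting
to weight `k` fixes the vector and removes the monomials of other weights, so only `mk_foldr_mem` in
weight `k` is needed. -/
theorem mk_mem_of_stronglyGenerated {σ : Type*} {x : σ → V} {w : σ → ℕ}
    (hw : ∀ i, x i ∈ gr (V := V) (w i)) (hgen : StronglyGeneratedBy (Set.range x)) {k : ℕ} {a : V}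
    (ha : a ∈ gr (V := V) k) :
    mk V a ∈ fil V k ⊔ Submodule.span ℂ {y | ∃ s : List σ, (s.map w).sum = k ∧
      y = (s.map fun i => mk V (x i)).prod} := by
  have h : (⊤ : Submodule ℂ V) ≤ (fil V k ⊔ Submodule.span ℂ {y | ∃ s : List σ,
      (s.map w).sum = k ∧ y = (s.map fun i => mk V (x i)).prod}).comap
        (mk V ∘ₗ weightProj k) := by
    rw [← show _ = _ from hgen, Submodule.span_le]
    rintro _ ⟨l, hl, rfl⟩
    obtain ⟨p, hp, hmem⟩ := mk_foldr_mem hw l hl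
    rw [SetLike.mem_coe, Submodule.mem_comap, LinearMap.comp_apply, weightProj_of_mem hp]
    split_ifs with hpk
    · rwa [← hpk]
    · simp
  have := h (Submodule.mem_top (x := a))
  rwa [Submodule.mem_comap, LinearMap.comp_apply, weightProj_of_mem ha, if_pos rfl] at this

theorem isAlmostCommFiltration_fil {σ : Type*} {x : σ → V} {w : σ → ℕ}
    (hw : ∀ i, x i ∈ gr (V := V) (w i)) (hgen : StronglyGeneratedBy (Set.range x)) :
    IsAlmostCommFiltration (fun i => mk V (x i)) w (fil V) where
  zero := fil_zero
  mono := fil_mono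
  exhaust := exists_mem_fil
  one_mem := mk_mem_fil one_pos vac_mem
  mul_mem_succ := mul_mem_fil
  gen_mem i := mk_mem_fil (Nat.lt_succ_self _) (hw i)
  comm_mem i j := mk_mul_comm_mem (hw i) (hw j)
  le_sup k := by
    conv_lhs => rw [fil]
    rw [Submodule.span_le]
    rintro _ ⟨j, hj, a, ha, rfl⟩
    -- Weights below `k` already lie in `fil V k`; strong generation is used only in weight exactly
    -- `k`.
    rcases (Nat.lt_succ_iff.1 hj).lt_or_eq with hj | rfl
    · exact Submodule.mem_sup_left (mk_mem_fil hj ha)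
    · exact mk_mem_of_stronglyGenerated hw hgen ha

end ZhuAlgebra

end VertexOperatorAlgebra

theorem corollary3p4 {V : Type*} [AddCommGroup V] [Module ℂ V] [VertexOperatorAlgebra V]
    (n : ℕ) (x : Fin n → V) (hx : ∀ i, VertexOperatorAlgebra.IsHomogeneous (x i))
    (hgen : VertexOperatorAlgebra.StronglyGeneratedBy (Set.range x)) :
    IsNoetherianRing (VertexOperatorAlgebra.ZhuAlgebra V) := by
  choose w hw using hx
  exact (VertexOperatorAlgebra.ZhuAlgebra.isAlmostCommFiltration_fil hw hgen).isNoetherianRing
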